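/- Let $d\ge 1$ be an integer. For $h>0$ and $f:(h\mathbb Z)^d\to\mathbb C$ write $f_j=f(hj)$, $j\in\mathbb Z^d$, and $$\Delta_{\mathrm d} f_j=\frac1{h^2}\sum_{k=1}^d\big(f_{j+e_k}-2f_j+f_{j-e_k}\big),\qquad \|f\|_\infty=\sup_{j}|f_j|,\qquad \|f\|_2=\Big(h^d\sum_{j\in\mathbb Z^d}|f_j|^2\Big)^{1/2},$$ where $e_k$ is the $k$-th unit vector. Let $|\cdot|$ also denote the Euclidean norm on $\mathbb R^d$. In the weights below, the exponents in (2) and (3) are read as $0$ at $j=0$. Consider solutions $u\in\ell^2((h\mathbb Z)^d)$ of $$\Delta_{\mathrm d} u_j+V_ju_j=0,\qquad j\in\mathbb Z^d,\tag{$*$}$$ where $V:(h\mathbb Z)^d\to\mathbb C$ is bounded. 1. There exists $\mu_0=\mu_0(d)>0$ such that for all constants $M,K,A$ there is $h_0>0$ with the following property: if $0<h<h_0$ and $u$ solves $(*)$ with $\|V\|_\infty\le M$, $\|u\|_2\le K$ and $$h^d\sum_{j\in\mathbb Z^d}e^{\mu_0|jh|^{4/3}}|u_j|^2\le A,$$ then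 $u\equiv0$. 2. There exists $\mu_0=\mu_0(d)>0$ such that for every $\beta>3$ and all constants $M,K,A$ there is $h_0>0$ with the following property: if $0<h<h_0$ and $u$ solves $(*)$ with $\|V\|_\infty\le M$, $\|u\|_2\le K$ and $$h^d\sum_{j\in\mathbb Z^d}e^{\mu_0|jh|^{1+\frac1\beta}\log(|j|h)}|u_j|^2\le A,$$ then $u\equiv0$. 3. There exists $\mu_0=\mu_0(d)>0$ such that for every $h>0$: if $u\in\ell^2((h\mathbb Z)^d)$ solves $(*)$ with $V$ bounded and $$h^d\sum_{j\in\mathbb Z^d}e^{\mu_0|j|\log(|j|h)}|u_j|^2<\infty,$$ then $u\equiv0$. -/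

import Mathlib

noncomputable section

namespace LatticeLandis

/-- Complex functions on the lattice `(hℤ)^d`, written through their values `f_j = f(hj)`,
`j ∈ ℤ^d`. -/
abbrev LatticeFun (d : ℕ) : Type := (Fin d → ℤ) → ℂ

/-- The Euclidean norm `|j|` of a multi-index `j ∈ ℤ^d`. -/
def indexNorm {d : ℕ} (j : Fin d → ℤ) : ℝ :=
  ‖(WithLp.toLp 2 (fun k => (j k : ℝ)) : EuclideanSpace ℝ (Fin d))‖

/-- The discrete Laplacian on `(hℤ)^d`:
`(Δ_d f)_j = h⁻² ∑_k (f_{j+e_k} - 2 f_j + f_{j-e_k})`. -/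
def discreteLaplacian {d : ℕ} (h : ℝ) (f : LatticeFun d) : LatticeFun d :=
  fun j => (1 / (h : ℂ) ^ 2) *
    ∑ k : Fin d, (f (j + Pi.single k 1) - 2 * f j + f (j - Pi.single k 1))

/-- `u` solves the stationary discrete Schrödinger equation `Δ_d u + V u = 0` on `(hℤ)^d`. -/
def IsStationarySolution {d : ℕ} (h : ℝ) (V u : LatticeFun d) : Prop :=
  ∀ j, discreteLaplacian h u j + V j * u j = 0

/-- `V` is bounded, with `‖V‖_∞ ≤ M`. -/
def SupNormLE {d : ℕ} (V : LatticeFun d) (M : ℝ) : Prop :=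
  ∀ j, ‖V j‖ ≤ M

/-- The sum `h^d ∑_j w_j |u_j|²` converges. -/
def WeightedSumFinite {d : ℕ} (w : (Fin d → ℤ) → ℝ) (u : LatticeFun d) : Prop :=
  Summable fun j => w j * ‖u j‖ ^ 2

/-- The sum `h^d ∑_j w_j |u_j|²` converges and its value is at most `A`. -/
def WeightedSumLE {d : ℕ} (h : ℝ) (w : (Fin d → ℤ) → ℝ) (u : LatticeFun d) (A : ℝ) : Prop :=
  WeightedSumFinite w u ∧ h ^ d * ∑' j, w j * ‖u j‖ ^ 2 ≤ A

/-- `u ∈ ℓ²((hℤ)^d)`. -/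
def MemL2 {d : ℕ} (u : LatticeFun d) : Prop :=
  Summable fun j => ‖u j‖ ^ 2

/-- `u ∈ ℓ²((hℤ)^d)` and `‖u‖₂ = (h^d ∑_j |u_j|²)^{1/2} ≤ K`. -/
def L2NormLE {d : ℕ} (h : ℝ) (u : LatticeFun d) (K : ℝ) : Prop :=
  MemL2 u ∧ Real.sqrt (h ^ d * ∑' j, ‖u j‖ ^ 2) ≤ K

end LatticeLandis

end

namespace LatticeLandis

/-! The equation at `j + e_m` expresses `u j` through sites whose `m`-th coordinate is at least `j m
+ 1`, with coefficients of total size at most `4d + h²M`. If `‖u j‖ ≤ B e^{-c j_m}` on the whole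
lattice, stepping forward gains `e^{-c}`; once `e^c ≥ 2(4d + h²M)` this halves `B`, and iteration
gives `u = 0`. Since `s log s` is superlinear, a weight `e^{κ s log s}` supplies such a bound for
every `c`, whatever `κ > 0` and `h`. All three weights dominate one of this kind. -/

/-- The supporting-line bound for the convex function `s ↦ s log s`. -/
lemma linear_le_mul_log (L : ℝ) {s : ℝ} (hs : 0 ≤ s) :
    L * s - Real.exp L ≤ s * Real.log s := by
  rcases hs.eq_or_lt with rfl | hs
  · simpa using (Real.exp_pos L).le
  · have h1 := Real.one_sub_inv_le_log_of_pos (div_pos hs (Real.exp_pos L))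
    rw [Real.log_div hs.ne' (Real.exp_pos L).ne', Real.log_exp, inv_div] at h1
    have h2 := mul_le_mul_of_nonneg_left h1 hs.le
    have h3 : s * (1 - Real.exp L / s) = s - Real.exp L := by field_simp
    rw [h3] at h2
    linarith

/-- The comparison of `s` with `s ^ p` reverses at `s = 1`, exactly where `log s` changes sign. -/
lemma mul_log_le_rpow_mul_log {p s : ℝ} (hp : 1 ≤ p) (hs : 0 ≤ s) :
    s * Real.log s ≤ s ^ p * Real.log s := by
  rcases le_total s 1 with h | h
  · exact mul_le_mul_of_nonpos_right
      (Real.rpow_le_self_of_le_one hs h hp) (Real.log_nonpos hs h)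
  · exact mul_le_mul_of_nonneg_right
      (Real.self_le_rpow_of_one_le h hp) (Real.log_nonneg h)

lemma mul_log_le_rpow_four_thirds {s : ℝ} (hs : 0 ≤ s) :
    1 / 3 * (s * Real.log s) ≤ s ^ (4 / 3 : ℝ) := by
  rcases hs.eq_or_lt with rfl | hs
  · simp
  · have h1 : Real.log (s ^ (1 / 3 : ℝ)) ≤ s ^ (1 / 3 : ℝ) := Real.log_le_self (by positivity)
    rw [Real.log_rpow hs] at h1
    have h2 : s ^ (4 / 3 : ℝ) = s * s ^ (1 / 3 : ℝ) := by
      rw [← Real.rpow_one_add' hs.le (by norm_num)]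
      norm_num
    rw [h2]
    nlinarith [mul_le_mul_of_nonneg_left h1 hs.le]

lemma indexNorm_nonneg {d : ℕ} (j : Fin d → ℤ) : 0 ≤ indexNorm j := norm_nonneg _

lemma apply_le_indexNorm {d : ℕ} (j : Fin d → ℤ) (k : Fin d) : (j k : ℝ) ≤ indexNorm j :=
  (le_abs_self _).trans
    (PiLp.norm_apply_le (WithLp.toLp 2 (fun k => (j k : ℝ)) : EuclideanSpace ℝ (Fin d)) k)

/-- The equation at `j + e_m`, solved for the value at `j`. -/
lemma IsStationarySolution.eq_of_forward {d : ℕ} {h : ℝ} (hh : h ≠ 0) {V u : LatticeFun d}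
    (hu : IsStationarySolution h V u) (m : Fin d) (j : Fin d → ℤ) :
    u j = (2 * d - (h : ℂ) ^ 2 * V (j + Pi.single m 1)) * u (j + Pi.single m 1)
      - ∑ k : Fin d, u (j + Pi.single m 1 + Pi.single k 1)
      - ∑ k ∈ Finset.univ.erase m, u (j + Pi.single m 1 - Pi.single k 1) := by
  have h1 := hu (j + Pi.single m 1)
  have hc : (h : ℂ) ≠ 0 := by exact_mod_cast hh
  simp only [discreteLaplacian, Finset.sum_add_distrib, Finset.sum_sub_distrib,
    Finset.sum_const, Finset.card_univ, Fintype.card_fin, nsmul_eq_mul] at h1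
  have h2 : ∑ k : Fin d, u (j + Pi.single m 1 - Pi.single k 1) =
      u j + ∑ k ∈ Finset.univ.erase m, u (j + Pi.single m 1 - Pi.single k 1) := by
    have h3 := (Finset.add_sum_erase Finset.univ
      (fun k : Fin d => u (j + Pi.single m 1 - Pi.single k 1)) (Finset.mem_univ m)).symm
    rwa [add_sub_cancel_right] at h3
  field_simp at h1
  linear_combination h1 - h2

/-- A solution bounded by `B e^{-c j_m}` is bounded by `(B / 2) e^{-c j_m}` once `e^c` is large
compared with the coefficients of the equation. -/
lemma IsStationarySolution.norm_le_half {d : ℕ} {h M c B : ℝ} (hh : 0 < h) (hM : 0 ≤ M)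
    (hc : 0 ≤ c) (hc' : 2 * (4 * d + h ^ 2 * M) ≤ Real.exp c) (hB : 0 ≤ B)
    {V u : LatticeFun d} (hV : SupNormLE V M) (hu : IsStationarySolution h V u) (m : Fin d)
    (hb : ∀ j, ‖u j‖ ≤ B * Real.exp (-c * j m)) (j : Fin d → ℤ) :
    ‖u j‖ ≤ B / 2 * Real.exp (-c * j m) := by
  set E : ℝ := B * Real.exp (-c * (j m + 1)) with hE
  have hE0 : 0 ≤ E := by positivity
  -- One constant `E` bounds `u` on the half-space containing every site on the right of
  -- `eq_of_forward`.
  have hnext : ∀ i : Fin d → ℤ, j m + 1 ≤ i m → ‖u i‖ ≤ E := fun i hi => by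
    refine (hb i).trans (mul_le_mul_of_nonneg_left (Real.exp_le_exp.mpr ?_) hB)
    have : (j m + 1 : ℝ) ≤ i m := by exact_mod_cast hi
    nlinarith
  have hcoef : ‖(2 * d - (h : ℂ) ^ 2 * V (j + Pi.single m 1))‖ ≤ 2 * d + h ^ 2 * M := by
    refine (norm_sub_le _ _).trans (add_le_add (by simp) ?_)
    rw [norm_mul, norm_pow, Complex.norm_real, Real.norm_of_nonneg hh.le]
    exact mul_le_mul_of_nonneg_left (hV _) (by positivity)
  have hcenter : ‖(2 * d - (h : ℂ) ^ 2 * V (j + Pi.single m 1)) * u (j + Pi.single m 1)‖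
      ≤ (2 * d + h ^ 2 * M) * E := by
    rw [norm_mul]
    exact mul_le_mul hcoef (hnext _ (by simp)) (norm_nonneg _) (by positivity)
  have hplus : ‖∑ k : Fin d, u (j + Pi.single m 1 + Pi.single k 1)‖ ≤ d * E := by
    refine (norm_sum_le_of_le _ (fun k _ => hnext _ ?_)).trans (by simp)
    by_cases hk : k = m
    · subst hk; simp
    · simp [Pi.single_eq_of_ne (Ne.symm hk)]
  have hminus : ‖∑ k ∈ Finset.univ.erase m, u (j + Pi.single m 1 - Pi.single k 1)‖ ≤ d * E := by
    refine (norm_sum_le_of_le (f := fun k => u (j + Pi.single m 1 - Pi.single k 1))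
      (n := fun _ => E) _ (fun k hk => hnext _ ?_)).trans ?_
    · simp [Pi.single_eq_of_ne (Ne.symm (Finset.ne_of_mem_erase hk))]
    · rw [Finset.sum_const, nsmul_eq_mul]
      refine mul_le_mul_of_nonneg_right ?_ hE0
      exact_mod_cast (Finset.card_erase_le).trans (by simp)
  have htotal : ‖u j‖ ≤ (4 * d + h ^ 2 * M) * E := by
    rw [hu.eq_of_forward hh.ne' m j]
    refine (norm_sub_le _ _).trans ((add_le_add_left (norm_sub_le _ _) _).trans ?_)
    linarith
  have hexp : Real.exp (-c * j m) = Real.exp c * Real.exp (-c * (j m + 1)) := by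
    rw [← Real.exp_add]; ring_nf
  rw [hexp]
  nlinarith [mul_le_mul_of_nonneg_right hc' hE0]

/-- A solution bounded by `B e^{-c j_m}`, with `e^c` large compared with the coefficients of the
equation, vanishes identically. -/
lemma IsStationarySolution.eq_zero_of_exp_bound {d : ℕ} {h M c B : ℝ} (hh : 0 < h) (hM : 0 ≤ M)
    (hc : 0 ≤ c) (hc' : 2 * (4 * d + h ^ 2 * M) ≤ Real.exp c) (hB : 0 ≤ B)
    {V u : LatticeFun d} (hV : SupNormLE V M) (hu : IsStationarySolution h V u) (m : Fin d)
    (hb : ∀ j, ‖u j‖ ≤ B * Real.exp (-c * j m)) : u = 0 := by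
  have hiter : ∀ n : ℕ, ∀ j, ‖u j‖ ≤ B * (1 / 2) ^ n * Real.exp (-c * j m) := by
    intro n
    induction n with
    | zero => simpa using hb
    | succ n ih =>
      intro j
      refine (hu.norm_le_half hh hM hc hc' (by positivity) hV m ih j).trans_eq ?_
      ring
  funext j
  have hlim : Filter.Tendsto (fun n : ℕ => B * (1 / 2) ^ n * Real.exp (-c * j m))
      Filter.atTop (nhds 0) := by
    simpa using ((tendsto_pow_atTop_nhds_zero_of_lt_one (r := (1 / 2 : ℝ))
      (by norm_num) (by norm_num)).const_mul B).mul_const (Real.exp (-c * j m))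
  exact norm_le_zero_iff.mp (ge_of_tendsto' hlim fun n => hiter n j)

/-- Unique continuation at infinity on the lattice: a solution with a bounded potential which is
square summable against a weight dominating `e^{κ s log s}`, `s = |j| h`, `κ > 0`, vanishes. -/
theorem IsStationarySolution.eq_zero_of_weighted {d : ℕ} (hd : 1 ≤ d) {h κ M : ℝ} (hh : 0 < h)
    (hκ : 0 < κ) {V u : LatticeFun d} (hV : SupNormLE V M) (hu : IsStationarySolution h V u)
    {φ : (Fin d → ℤ) → ℝ}
    (hφ : ∀ j, κ * (indexNorm j * h * Real.log (indexNorm j * h)) ≤ φ j)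
    (hw : WeightedSumFinite (fun j => Real.exp (φ j)) u) : u = 0 := by
  have hM : 0 ≤ M := (norm_nonneg _).trans (hV 0)
  set C : ℝ := 2 * (4 * d + h ^ 2 * M) with hC
  have hC0 : 0 ≤ C := by positivity
  have hCc : C ≤ Real.exp C := by linarith [Real.add_one_le_exp C]
  -- Slope chosen so that `κ h L = 2C`: the weight controls `‖u j‖ ^ 2`, so rate `2C` there means
  -- rate `C` for `u`.
  set L : ℝ := 2 * C / (κ * h) with hL
  set D : ℝ := κ * Real.exp L with hD
  have hlow : ∀ j, 2 * C * indexNorm j - D ≤ φ j := fun j => by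
    have h1 := mul_le_mul_of_nonneg_left
      (linear_le_mul_log L (mul_nonneg (indexNorm_nonneg j) hh.le)) hκ.le
    have h2 : κ * (L * (indexNorm j * h) - Real.exp L) = 2 * C * indexNorm j - D := by
      have h3 : κ * h * L = 2 * C := by rw [hL]; field_simp
      rw [hD]; linear_combination indexNorm j * h3
    rw [h2] at h1
    exact h1.trans (hφ j)
  set S : ℝ := ∑' j, Real.exp (φ j) * ‖u j‖ ^ 2 with hS
  have hS0 : 0 ≤ S := tsum_nonneg fun j => by positivity
  refine hu.eq_zero_of_exp_bound (B := Real.sqrt (S * Real.exp D)) hh hM hC0 hCc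
    (Real.sqrt_nonneg _) hV ⟨0, hd⟩ fun j => ?_
  have hterm : Real.exp (φ j) * ‖u j‖ ^ 2 ≤ S :=
    hw.le_tsum j fun i _ => by positivity
  have hexp : Real.exp (2 * C * j ⟨0, hd⟩ - D) ≤ Real.exp (φ j) := by
    refine Real.exp_le_exp.mpr (le_trans ?_ (hlow j))
    -- Only `j m ≤ |j|` is needed; where `j m < 0` the bound may grow.
    nlinarith [apply_le_indexNorm j ⟨0, hd⟩]
  have hS' := (mul_le_mul_of_nonneg_right hexp (sq_nonneg ‖u j‖)).trans hterm
  refine (sq_le_sq₀ (norm_nonneg _) (by positivity)).mp ?_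
  rw [mul_pow, Real.sq_sqrt (by positivity), ← Real.exp_nat_mul]
  calc ‖u j‖ ^ 2 = Real.exp (2 * C * j ⟨0, hd⟩ - D) * ‖u j‖ ^ 2
        * (Real.exp D * Real.exp ((2 : ℕ) * (-C * j ⟨0, hd⟩))) := by
        rw [mul_right_comm, ← Real.exp_add, ← Real.exp_add]
        ring_nf
        simp
    _ ≤ S * (Real.exp D * Real.exp ((2 : ℕ) * (-C * j ⟨0, hd⟩))) :=
        mul_le_mul_of_nonneg_right hS' (by positivity)
    _ = _ := by ring

end LatticeLandis

open LatticeLandis in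
theorem theorem1p2 (d : ℕ) (hd : 1 ≤ d) :
    -- (1) close-to-continuum decay
    (∃ μ₀ : ℝ, 0 < μ₀ ∧ ∀ M K A : ℝ, ∃ h₀ : ℝ, 0 < h₀ ∧
      ∀ h : ℝ, 0 < h → h < h₀ → ∀ V u : LatticeFun d,
        SupNormLE V M → L2NormLE h u K → IsStationarySolution h V u →
        WeightedSumLE h
          (fun j => Real.exp (μ₀ * (indexNorm j * h) ^ (4 / 3 : ℝ))) u A →
        u = 0) ∧
    -- (2) interpolating decay
    (∃ μ₀ : ℝ, 0 < μ₀ ∧ ∀ β : ℝ, 3 < β → ∀ M K A : ℝ, ∃ h₀ : ℝ, 0 < h₀ ∧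
      ∀ h : ℝ, 0 < h → h < h₀ → ∀ V u : LatticeFun d,
        SupNormLE V M → L2NormLE h u K → IsStationarySolution h V u →
        WeightedSumLE h
          (fun j => Real.exp (μ₀ * (indexNorm j * h) ^ (1 + 1 / β : ℝ) *
            Real.log (indexNorm j * h))) u A →
        u = 0) ∧
    -- (3) purely discrete decay, for each fixed mesh size
    (∃ μ₀ : ℝ, 0 < μ₀ ∧ ∀ h : ℝ, 0 < h → ∀ V u : LatticeFun d,
        (∃ M : ℝ, SupNormLE V M) → MemL2 u → IsStationarySolution h V u →
        WeightedSumFinite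
          (fun j => Real.exp (μ₀ * indexNorm j * Real.log (indexNorm j * h))) u →
        u = 0) := by
  -- Any positive `μ₀` and `h₀` would serve.
  refine ⟨⟨1, one_pos, fun M K A => ⟨1, one_pos, fun h hh _ V u hV _ hu hw => ?_⟩⟩,
    ⟨1, one_pos, fun β hβ M K A => ⟨1, one_pos, fun h hh _ V u hV _ hu hw => ?_⟩⟩,
    ⟨1, one_pos, fun h hh V u ⟨M, hV⟩ _ hu hw => ?_⟩⟩
  · refine hu.eq_zero_of_weighted hd hh (κ := 1 / 3) (by norm_num) hV (fun j => ?_) hw.1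
    rw [one_mul]
    exact mul_log_le_rpow_four_thirds (mul_nonneg (indexNorm_nonneg j) hh.le)
  · refine hu.eq_zero_of_weighted hd hh (κ := 1) one_pos hV (fun j => ?_) hw.1
    rw [one_mul, one_mul]
    have hβ' : 0 < 1 / β := by positivity
    exact mul_log_le_rpow_mul_log (by linarith) (mul_nonneg (indexNorm_nonneg j) hh.le)
  -- The factor `1 / h` turns `|j| h` back into the `|j|` of this exponent.
  · refine hu.eq_zero_of_weighted hd hh (κ := 1 / h) (by positivity) hV (fun j => ?_) hw
    apply le_of_eq
    field_simp
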